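/- Let $N\ge 2$, $0<s<1$ and $\frac{2}{2-s}<p<\infty$. Let $\Omega\subset\mathbb R^N$ be a bounded open set with $C^2$ boundary, $d(x)=\operatorname{dist}(x,\partial\Omega)$, and for $\delta>0$ let $\Omega_\delta=\{x\in\Omega: d(x)<\delta\}$. For $\delta_0>0$ such that $d$ is $C^2$ in $\Omega_{\delta_0}$ and for $\beta>0$, call $\xi:\mathbb R^N\to\mathbb R$ a barrier with exponent $\beta$ and width $\delta_0$ if $\xi=d^\beta$ in $\Omega_{\delta_0}$, $\xi=0$ in $\mathbb R^N\setminus\Omega$, $\xi$ is positive and $C^2$ in $\Omega$, and $\xi\ge d^\beta$ in $\Omega\setminus\Omega_{\delta_0}$ (every barrier is bounded). Let $$(-\Delta)_p^s u(x)=2\lim_{\varepsilon\to0^+}\int_{\mathbb R^N\setminus B(x,\varepsilon)}\frac{|u(x)-u(y)|^{p-2}(u(x)-u(y))}{|x-y|^{N+sp}}\,dy .$$ There exist $C>0$ and $\beta_0\in\left(0,\frac{sp}{p-1}\right)$, depending only on $N,s,p,\Omega$, such that for every $\delta_0>0$ for which $d$ is $C^2$ in $\Omega_{\delta_0}$ and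 every $M\in\mathbb R$ there exists $\delta\in(0,\delta_0]$ with the following property. For every $\beta\in(0,\beta_0)$, every barrier $\xi$ with exponent $\beta$ and width $\delta_0$ that satisfies $\xi\le M$, and every $x\in\Omega_\delta$, the integrals defining $(-\Delta)_p^s\xi(x)$ converge absolutely for each $\varepsilon>0$, the limit exists and is finite, and $$-(-\Delta)_p^s\xi(x)\le -C\,d(x)^{\beta(p-1)-sp}.$$ -/

import Mathlib

open Set Filter Topology MeasureTheory

/-- `Ω` has a boundary of class `C²`, with `Ω` locally on one side of it: near each boundary
point, `Ω` is the sublevel set of a `C²` function without critical points. -/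
def HasC2Boundary {N : ℕ} (Ω : Set (EuclideanSpace ℝ (Fin N))) : Prop :=
  ∀ x₀ ∈ frontier Ω, ∃ U : Set (EuclideanSpace ℝ (Fin N)), IsOpen U ∧ x₀ ∈ U ∧
    ∃ φ : EuclideanSpace ℝ (Fin N) → ℝ, ContDiffOn ℝ 2 φ U ∧
      (∀ x ∈ U, fderiv ℝ φ x ≠ 0) ∧ Ω ∩ U = {x ∈ U | φ x < 0}

/-- The distance `d(x) = dist(x, ∂Ω)` to the boundary. -/
noncomputable def bdryDist {N : ℕ} (Ω : Set (EuclideanSpace ℝ (Fin N)))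
    (x : EuclideanSpace ℝ (Fin N)) : ℝ :=
  Metric.infDist x (frontier Ω)

/-- The boundary strip `Ω_δ = {x ∈ Ω : d(x) < δ}`. -/
def bdryStrip {N : ℕ} (Ω : Set (EuclideanSpace ℝ (Fin N))) (δ : ℝ) :
    Set (EuclideanSpace ℝ (Fin N)) :=
  {x ∈ Ω | bdryDist Ω x < δ}

/-- The integrand `|u(x)-u(y)|^{p-2} (u(x)-u(y)) / |x-y|^{N+sp}` of the fractional
`p`-Laplacian. -/
noncomputable def fracPLapIntegrand {N : ℕ} (s p : ℝ) (u : EuclideanSpace ℝ (Fin N) → ℝ)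
    (x y : EuclideanSpace ℝ (Fin N)) : ℝ :=
  |u x - u y| ^ (p - 2) * (u x - u y) / ‖x - y‖ ^ ((N : ℝ) + s * p)

/-- The truncated operator: twice the integral over the complement of the ball `B(x, ε)`. -/
noncomputable def fracPLapTrunc {N : ℕ} (s p : ℝ) (u : EuclideanSpace ℝ (Fin N) → ℝ)
    (x : EuclideanSpace ℝ (Fin N)) (ε : ℝ) : ℝ :=
  2 * ∫ y in (Metric.ball x ε)ᶜ, fracPLapIntegrand s p u x y

/-- The principal value defining `(-Δ)_p^s u(x)` makes sense: all truncated integrals converge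
absolutely, and they have a finite limit as `ε → 0⁺`. -/
def FracPLapExists {N : ℕ} (s p : ℝ) (u : EuclideanSpace ℝ (Fin N) → ℝ)
    (x : EuclideanSpace ℝ (Fin N)) : Prop :=
  (∀ ε : ℝ, 0 < ε → IntegrableOn (fracPLapIntegrand s p u x) (Metric.ball x ε)ᶜ volume) ∧
    ∃ L : ℝ, Tendsto (fracPLapTrunc s p u x) (𝓝[>] 0) (𝓝 L)

/-- The fractional `p`-Laplacian `(-Δ)_p^s u(x)`, as a principal value (meaningful when
`FracPLapExists s p u x` holds). -/
noncomputable def fracPLap {N : ℕ} (s p : ℝ) (u : EuclideanSpace ℝ (Fin N) → ℝ)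
    (x : EuclideanSpace ℝ (Fin N)) : ℝ :=
  limUnder (𝓝[>] (0 : ℝ)) (fracPLapTrunc s p u x)

/-- `ξ` is a barrier for `Ω` with exponent `β` and strip width `δ₀`: it is `d^β` in `Ω_{δ₀}`, it is
`0` outside `Ω`, it is positive and `C²` in `Ω`, and it is at least `d^β` in `Ω \ Ω_{δ₀}`. -/
structure IsBarrier {N : ℕ} (Ω : Set (EuclideanSpace ℝ (Fin N))) (δ₀ β : ℝ)
    (ξ : EuclideanSpace ℝ (Fin N) → ℝ) : Prop where
  eq_strip : ∀ x ∈ bdryStrip Ω δ₀, ξ x = bdryDist Ω x ^ β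
  eq_zero : ∀ x ∉ Ω, ξ x = 0
  pos : ∀ x ∈ Ω, 0 < ξ x
  contDiffOn : ContDiffOn ℝ 2 ξ Ω
  ge_inner : ∀ x ∈ Ω \ bdryStrip Ω δ₀, bdryDist Ω x ^ β ≤ ξ x

/-! Fix `x` near the boundary, put r = d(x), let z be a nearest boundary point, and write P =
r^(β(p-1)-sp). Every contribution to the operator at `x` is compared with P; the favourable one has
a coefficient independent of β, while the unfavourable ones carry a factor β^(p-1) or stay bounded
as r → 0.

Favourable: a ball of radius κr outside Ω lies within 3r of `x`. There the barrier vanishes, so the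
integrand is at least (r^β)^(p-1) (3r)^(-N-sp), and the integral gains cP
(`HasC2Boundary.exists_exterior_balls`, `IsBarrier.le_integral_compl_ball`).

Near `x`: since d(y) ≤ |y-z|, the smooth function |y-z|^β touches the barrier from above at `x`. Its
gradient and second-order term at scale r have size βr^β. The odd linear part integrates to zero
over annuli, so the loss is O(β^(p-1))P, uniformly in the inner radius
(`exists_neg_le_integral_annulus`, `IsBarrier.exists_paraboloid`).

Far from `x`: T^β - 1 ≤ (β/γ)T^γ for T ≥ 1, with γ(p-1) = sp/2, gives an integrable tail and again a
loss O(β^(p-1))P. Where d ≥ δ₀, only ξ ≤ M is available; this loses a constant, which is absorbed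
for small r because P ≥ r^(-sp/2).

The principal value exists because, after removal of the odd linear part, the integrand is
O(|x-y|^(min(p,2(p-1))-N-sp)), and sp < min(p,2(p-1)) by s < 1 and p > 2/(2-s). -/

open Set Filter Topology MeasureTheory

/-! ### Elementary estimates for the odd power -/

/-- The odd power `|t|^{p-2} t`. -/
noncomputable def oddPow (p t : ℝ) : ℝ := |t| ^ (p - 2) * t

theorem oddPow_neg (p t : ℝ) : oddPow p (-t) = -oddPow p t := by
  simp [oddPow]

theorem oddPow_of_nonneg {p t : ℝ} (hp : 1 < p) (ht : 0 ≤ t) : oddPow p t = t ^ (p - 1) := by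
  rcases ht.eq_or_lt with rfl | ht
  · simp [oddPow, Real.zero_rpow (by linarith : p - 1 ≠ 0)]
  · rw [oddPow, abs_of_pos ht, ← Real.rpow_add_one ht.ne']
    ring_nf

theorem oddPow_neg_of_nonneg {p t : ℝ} (hp : 1 < p) (ht : 0 ≤ t) :
    oddPow p (-t) = -t ^ (p - 1) := by
  rw [oddPow_neg, oddPow_of_nonneg hp ht]

theorem abs_oddPow {p : ℝ} (hp : 1 < p) (t : ℝ) : |oddPow p t| = |t| ^ (p - 1) := by
  rw [← oddPow_of_nonneg hp (abs_nonneg t), oddPow, oddPow, abs_mul, abs_abs,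
    abs_of_nonneg (Real.rpow_nonneg (abs_nonneg t) _)]

theorem oddPow_mul {p A : ℝ} (hp : 1 < p) (hA : 0 ≤ A) (t : ℝ) :
    oddPow p (A * t) = A ^ (p - 1) * oddPow p t := by
  rw [← oddPow_of_nonneg hp hA, oddPow, oddPow, oddPow, abs_mul,
    Real.mul_rpow (abs_nonneg _) (abs_nonneg _)]
  ring

theorem measurable_oddPow (p : ℝ) : Measurable (oddPow p) := by
  unfold oddPow
  fun_prop

theorem monotone_oddPow {p : ℝ} (hp : 1 < p) : Monotone (oddPow p) := by
  have key : ∀ a b : ℝ, 0 ≤ a → a ≤ b → oddPow p a ≤ oddPow p b := fun a b ha hab => by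
    rw [oddPow_of_nonneg hp ha, oddPow_of_nonneg hp (ha.trans hab)]
    exact Real.rpow_le_rpow ha hab (by linarith)
  have h0 : oddPow p 0 = 0 := by simp [oddPow]
  intro a b hab
  rcases le_total 0 a with ha | ha
  · exact key a b ha hab
  · rcases le_total 0 b with hb | hb
    · have h1 := key 0 b le_rfl hb
      have h2 := key 0 (-a) le_rfl (by linarith)
      rw [oddPow_neg] at h2
      linarith
    · have h2 := key (-b) (-a) (by linarith) (by linarith)
      rw [oddPow_neg, oddPow_neg] at h2
      linarith

/-- Subadditivity of the power for q ≤ 1; for q ≥ 1, Bernoulli's inequality at v/u, that is,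
convexity. -/
theorem exists_rpow_sub_rpow_le {q : ℝ} (hq : 0 < q) :
    ∃ C : ℝ, 0 ≤ C ∧ ∀ u v : ℝ, 0 ≤ v → v ≤ u → u ≤ 2 →
      u ^ q - v ^ q ≤ C * (u - v) ^ min 1 q := by
  rcases le_total q 1 with h | h
  · refine ⟨1, zero_le_one, fun u v hv huv _ => ?_⟩
    have := Real.rpow_add_le_add_rpow (sub_nonneg.2 huv) hv hq.le h
    rw [sub_add_cancel] at this
    rw [min_eq_right h]
    linarith
  · refine ⟨q * 2 ^ (q - 1), by positivity, fun u v hv huv hu => ?_⟩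
    rw [min_eq_left h, Real.rpow_one]
    rcases (hv.trans huv).eq_or_lt with rfl | hu0
    · have : v = 0 := le_antisymm huv hv
      simp [this]
    · have h1 := one_add_mul_self_le_rpow_one_add (s := v / u - 1)
        (by have : 0 ≤ v / u := by positivity
            linarith) h
      rw [add_sub_cancel, Real.div_rpow hv hu0.le, le_div_iff₀ (by positivity)] at h1
      have h2 : u ^ q = u ^ (q - 1) * u := by rw [← Real.rpow_add_one hu0.ne']; ring_nf
      have h3 : u ^ (q - 1) ≤ 2 ^ (q - 1) := Real.rpow_le_rpow hu0.le hu (by linarith)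
      have h4 : (1 + q * (v / u - 1)) * u ^ q = u ^ q - q * u ^ (q - 1) * (u - v) := by
        rw [h2]; field_simp; ring
      have h5 : q * u ^ (q - 1) * (u - v) ≤ q * 2 ^ (q - 1) * (u - v) := by
        have := sub_nonneg.2 huv
        gcongr
      linarith

/-- Arguments of equal sign reduce to the preceding power estimate; for opposite signs each power is
bounded separately, whence the factor 2. The range [-2, 2] is what the rescaled perturbation
estimate needs. -/
theorem exists_abs_oddPow_sub_le {p : ℝ} (hp : 1 < p) :
    ∃ C : ℝ, 0 ≤ C ∧ ∀ u v : ℝ, |u| ≤ 2 → |v| ≤ 2 →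
      |oddPow p u - oddPow p v| ≤ C * |u - v| ^ min 1 (p - 1) := by
  obtain ⟨C, hC, h⟩ := exists_rpow_sub_rpow_le (q := p - 1) (by linarith)
  have hm : 0 < min 1 (p - 1) := lt_min one_pos (by linarith)
  have hm0 : min 1 (p - 1) ≠ 0 := hm.ne'
  refine ⟨2 * C, by positivity, ?_⟩
  have same : ∀ u v : ℝ, 0 ≤ v → v ≤ u → u ≤ 2 →
      |oddPow p u - oddPow p v| ≤ 2 * C * |u - v| ^ min 1 (p - 1) := fun u v hv huv hu => by
    rw [abs_of_nonneg (sub_nonneg.2 (monotone_oddPow hp huv)), abs_of_nonneg (sub_nonneg.2 huv),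
      oddPow_of_nonneg hp hv, oddPow_of_nonneg hp (hv.trans huv)]
    have h1 := h u v hv huv hu
    have h2 : 0 ≤ C * (u - v) ^ min 1 (p - 1) :=
      mul_nonneg hC (Real.rpow_nonneg (sub_nonneg.2 huv) _)
    linarith
  have opp : ∀ u v : ℝ, 0 ≤ v → 0 ≤ u → v ≤ 2 → u ≤ 2 →
      |oddPow p u - oddPow p (-v)| ≤ 2 * C * |u - -v| ^ min 1 (p - 1) := fun u v hv hu hv2 hu2 => by
    have hq : p - 1 ≠ 0 := by linarith
    have e1 := h u 0 le_rfl hu hu2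
    have e2 := h v 0 le_rfl hv hv2
    rw [Real.zero_rpow hq, sub_zero, sub_zero] at e1 e2
    have e3 : u ^ min 1 (p - 1) ≤ (u + v) ^ min 1 (p - 1) :=
      Real.rpow_le_rpow hu (by linarith) hm.le
    have e4 : v ^ min 1 (p - 1) ≤ (u + v) ^ min 1 (p - 1) :=
      Real.rpow_le_rpow hv (by linarith) hm.le
    rw [oddPow_neg, sub_neg_eq_add, sub_neg_eq_add, oddPow_of_nonneg hp hv, oddPow_of_nonneg hp hu,
      abs_of_nonneg (by positivity), abs_of_nonneg (by positivity : 0 ≤ u + v)]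
    nlinarith [mul_le_mul_of_nonneg_left e3 hC, mul_le_mul_of_nonneg_left e4 hC]
  have main : ∀ u v : ℝ, 0 ≤ u → |u| ≤ 2 → |v| ≤ 2 →
      |oddPow p u - oddPow p v| ≤ 2 * C * |u - v| ^ min 1 (p - 1) := fun u v hu0 hu hv => by
    rw [abs_le] at hu hv
    rcases le_total 0 v with h1 | h1
    · rcases le_total v u with h2 | h2
      · exact same u v h1 h2 hu.2
      · rw [abs_sub_comm, abs_sub_comm u v]
        exact same v u hu0 h2 hv.2
    · have := opp u (-v) (by linarith) hu0 (by linarith) hu.2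
      rwa [neg_neg] at this
  intro u v hu hv
  rcases le_total 0 u with h1 | h1
  · exact main u v h1 hu hv
  · have := main (-u) (-v) (by linarith) (by rwa [abs_neg]) (by rwa [abs_neg])
    rw [oddPow_neg, oddPow_neg] at this
    rw [← abs_neg, ← abs_neg (u - v)]
    convert this using 3 <;> ring_nf

/-- By homogeneity, dividing by At leaves a bounded argument perturbed by at most t. Hölder
continuity then gives the exponent (p-1) + min(1, p-1) = min(p, 2(p-1)), which decides convergence
of the principal value. -/
theorem exists_abs_oddPow_add_sub_le {p : ℝ} (hp : 1 < p) :
    ∃ C : ℝ, 0 ≤ C ∧ ∀ A t a b : ℝ, 0 ≤ A → 0 ≤ t → t ≤ 1 → |a| ≤ A * t → |b| ≤ A * t ^ 2 →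
      |oddPow p (a + b) - oddPow p a| ≤ C * A ^ (p - 1) * t ^ min p (2 * (p - 1)) := by
  obtain ⟨C, hC, h⟩ := exists_abs_oddPow_sub_le hp
  have hm : 0 < min 1 (p - 1) := lt_min one_pos (by linarith)
  refine ⟨C, hC, fun A t a b hA ht ht1 ha hb => ?_⟩
  rcases hA.eq_or_lt with rfl | hA
  · have hb0 : b = 0 := by simpa using hb
    simp only [hb0, add_zero, sub_self, abs_zero]
    rw [Real.zero_rpow (by linarith)]; simp
  rcases ht.eq_or_lt with rfl | ht
  · have hb0 : b = 0 := by simpa using hb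
    simp only [hb0, add_zero, sub_self, abs_zero]
    positivity
  have hAt : 0 < A * t := by positivity
  obtain ⟨α, rfl⟩ : ∃ α, a = A * t * α := ⟨a / (A * t), by field_simp⟩
  obtain ⟨κ, rfl⟩ : ∃ κ, b = A * t * κ := ⟨b / (A * t), by field_simp⟩
  have hα : |α| ≤ 1 := by
    rw [abs_mul, abs_of_pos hAt] at ha
    nlinarith
  have hκ : |κ| ≤ t := by
    rw [abs_mul, abs_of_pos hAt] at hb
    have : A * t * |κ| ≤ A * t * t := by linarith
    exact le_of_mul_le_mul_left this hAt
  have h1 := h (α + κ) α ((abs_add_le _ _).trans (by linarith)) (by linarith)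
  rw [← mul_add, oddPow_mul hp hAt.le, oddPow_mul hp hAt.le, ← mul_sub, abs_mul,
    abs_of_nonneg (by positivity : 0 ≤ (A * t) ^ (p - 1)), Real.mul_rpow hA.le ht.le]
  rw [add_sub_cancel_left] at h1
  have h2 : |κ| ^ min 1 (p - 1) ≤ t ^ min 1 (p - 1) :=
    Real.rpow_le_rpow (abs_nonneg _) hκ hm.le
  have h3 : t ^ min p (2 * (p - 1)) = t ^ (p - 1) * t ^ min 1 (p - 1) := by
    rw [← Real.rpow_add ht, ← min_add_add_left]
    ring_nf
  rw [h3]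
  calc A ^ (p - 1) * t ^ (p - 1) * |oddPow p (α + κ) - oddPow p α|
      ≤ A ^ (p - 1) * t ^ (p - 1) * (C * t ^ min 1 (p - 1)) := by
        gcongr
        exact h1.trans (by gcongr)
    _ = _ := by ring

/-! ### Radial power integrals and cancellation of odd functions -/

theorem pow_pred_finrank_mul_rpow {E : Type*} [NormedAddCommGroup E] [NormedSpace ℝ E]
    [FiniteDimensional ℝ E] [Nontrivial E] {t : ℝ} (ht : 0 < t) (b : ℝ) :
    t ^ (Module.finrank ℝ E - 1) * t ^ (b - Module.finrank ℝ E) = t ^ (b - 1) := by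
  have h : 1 ≤ Module.finrank ℝ E := Module.finrank_pos
  rw [← Real.rpow_natCast, ← Real.rpow_add ht]
  push_cast [h]
  ring_nf

theorem indicator_ball_eq {E : Type*} [NormedAddCommGroup E] (x : E) (R : ℝ) (f : ℝ → ℝ) :
    (Metric.ball x R).indicator (fun y => f ‖x - y‖) =
      fun y => (Iio R).indicator f ‖x - y‖ := by
  ext y
  simp [indicator, dist_eq_norm']

theorem indicator_compl_ball_eq {E : Type*} [NormedAddCommGroup E] (x : E) (R : ℝ) (f : ℝ → ℝ) :
    (Metric.ball x R)ᶜ.indicator (fun y => f ‖x - y‖) =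
      fun y => (Ici R).indicator f ‖x - y‖ := by
  ext y
  simp [indicator, dist_eq_norm']

section PowerIntegrals

variable {E : Type*} [NormedAddCommGroup E] [NormedSpace ℝ E] [FiniteDimensional ℝ E]
  [MeasurableSpace E] [BorelSpace E] [Nontrivial E] (μ : Measure E) [μ.IsAddHaarMeasure]

theorem integrable_radial_sub {f : ℝ → ℝ}
    (hf : IntegrableOn (fun t => t ^ (Module.finrank ℝ E - 1) • f t) (Ioi 0)) (x : E) :
    Integrable (fun y => f ‖x - y‖) μ :=
  ((integrable_fun_norm_addHaar μ).2 hf).comp_sub_left x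

theorem integral_radial_sub (f : ℝ → ℝ) (x : E) :
    ∫ y, f ‖x - y‖ ∂μ = Module.finrank ℝ E * (μ.real (Metric.ball 0 1) *
      ∫ t in Ioi (0 : ℝ), t ^ (Module.finrank ℝ E - 1) • f t) := by
  rw [integral_sub_left_eq_self (fun z => f ‖z‖) μ x, integral_fun_norm_addHaar]
  simp

theorem integrableOn_ball_rpow (x : E) {R b : ℝ} (hb : 0 < b) :
    IntegrableOn (fun y => ‖x - y‖ ^ (b - Module.finrank ℝ E)) (Metric.ball x R) μ := by
  rw [← integrable_indicator_iff Metric.isOpen_ball.measurableSet,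
    indicator_ball_eq x R (fun t => t ^ (b - Module.finrank ℝ E))]
  apply integrable_radial_sub
  have h1 : IntegrableOn (fun t : ℝ => t ^ (b - 1)) (Ioo 0 R) := by
    rcases le_total 0 R with hR | hR
    · exact (((intervalIntegrable_iff_integrableOn_Ioc_of_le hR).1
        (intervalIntegral.intervalIntegrable_rpow' (by linarith)))).mono_set Ioo_subset_Ioc_self
    · rw [Ioo_eq_empty (by linarith)]; exact integrableOn_empty
  have h2 : IntegrableOn ((Iio R).indicator fun t : ℝ => t ^ (b - 1)) (Ioi 0) := by
    rw [IntegrableOn, integrable_indicator_iff measurableSet_Iio, IntegrableOn,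
      Measure.restrict_restrict measurableSet_Iio, Set.inter_comm, Ioi_inter_Iio]
    exact h1
  refine h2.congr_fun (fun t ht => ?_) measurableSet_Ioi
  by_cases h : t ∈ Iio R
  · simp [h, pow_pred_finrank_mul_rpow ht]
  · simp [h]

theorem integral_ball_rpow (x : E) {R b : ℝ} (hR : 0 < R) (hb : 0 < b) :
    ∫ y in Metric.ball x R, ‖x - y‖ ^ (b - Module.finrank ℝ E) ∂μ =
      Module.finrank ℝ E * μ.real (Metric.ball 0 1) / b * R ^ b := by
  rw [← integral_indicator Metric.isOpen_ball.measurableSet,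
    indicator_ball_eq x R (fun t => t ^ (b - Module.finrank ℝ E)), integral_radial_sub]
  have h : ∫ t in Ioi (0 : ℝ), t ^ (Module.finrank ℝ E - 1) •
      (Iio R).indicator (fun t => t ^ (b - Module.finrank ℝ E)) t = R ^ b / b := by
    calc _ = ∫ t in Ioi (0 : ℝ), (Iio R).indicator (fun t : ℝ => t ^ (b - 1)) t := by
          refine setIntegral_congr_fun measurableSet_Ioi fun t ht => ?_
          by_cases h : t ∈ Iio R
          · simp [h, pow_pred_finrank_mul_rpow ht]
          · simp [h]
      _ = ∫ t in Ioo 0 R, t ^ (b - 1) := by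
          rw [setIntegral_indicator measurableSet_Iio, Ioi_inter_Iio]
      _ = R ^ b / b := by
          rw [← integral_Ioc_eq_integral_Ioo, ← intervalIntegral.integral_of_le hR.le,
            integral_rpow (Or.inl (by linarith))]
          simp [Real.zero_rpow hb.ne']
  rw [h]
  ring

theorem integrableOn_compl_ball_rpow (x : E) {R a : ℝ} (hR : 0 < R) (ha : 0 < a) :
    IntegrableOn (fun y => ‖x - y‖ ^ (-a - Module.finrank ℝ E)) (Metric.ball x R)ᶜ μ := by
  rw [← integrable_indicator_iff Metric.isOpen_ball.measurableSet.compl,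
    indicator_compl_ball_eq x R (fun t => t ^ (-a - Module.finrank ℝ E))]
  apply integrable_radial_sub
  have h1 : IntegrableOn (fun t : ℝ => t ^ (-a - 1)) (Ici R) :=
    (integrableOn_Ici_iff_integrableOn_Ioi (by simp)).2 (integrableOn_Ioi_rpow_of_lt (by linarith) hR)
  have h2 : IntegrableOn ((Ici R).indicator fun t : ℝ => t ^ (-a - 1)) (Ioi 0) :=
    ((integrable_indicator_iff measurableSet_Ici).2 h1).integrableOn
  refine h2.congr_fun (fun t ht => ?_) measurableSet_Ioi
  by_cases h : t ∈ Ici R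
  · simp [h, pow_pred_finrank_mul_rpow ht]
  · simp [h]

theorem integral_compl_ball_rpow (x : E) {R a : ℝ} (hR : 0 < R) (ha : 0 < a) :
    ∫ y in (Metric.ball x R)ᶜ, ‖x - y‖ ^ (-a - Module.finrank ℝ E) ∂μ =
      Module.finrank ℝ E * μ.real (Metric.ball 0 1) / a * R ^ (-a) := by
  rw [← integral_indicator Metric.isOpen_ball.measurableSet.compl,
    indicator_compl_ball_eq x R (fun t => t ^ (-a - Module.finrank ℝ E)), integral_radial_sub]
  have h : ∫ t in Ioi (0 : ℝ), t ^ (Module.finrank ℝ E - 1) •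
      (Ici R).indicator (fun t => t ^ (-a - Module.finrank ℝ E)) t = R ^ (-a) / a := by
    calc _ = ∫ t in Ioi (0 : ℝ), (Ici R).indicator (fun t : ℝ => t ^ (-a - 1)) t := by
          refine setIntegral_congr_fun measurableSet_Ioi fun t ht => ?_
          by_cases h : t ∈ Ici R
          · simp [h, pow_pred_finrank_mul_rpow ht]
          · simp [h]
      _ = ∫ t in Ici R, t ^ (-a - 1) := by
          rw [setIntegral_indicator measurableSet_Ici,
            inter_eq_right.2 (Ici_subset_Ioi.2 hR)]
      _ = R ^ (-a) / a := by
          rw [integral_Ici_eq_integral_Ioi, integral_Ioi_rpow_of_lt (by linarith) hR]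
          simp [neg_div, div_neg]
  rw [h]
  ring

end PowerIntegrals

/-- Cut off to the centred annulus, `g` stays odd, and Haar measure is invariant under negation, so
the integral equals its own negative. No integrability is needed, as the default value 0 is
consistent with this. -/
theorem integral_annulus_eq_zero_of_odd {E : Type*} [NormedAddCommGroup E] [NormedSpace ℝ E]
    [FiniteDimensional ℝ E] [MeasurableSpace E] [BorelSpace E] (μ : Measure E) [μ.IsAddHaarMeasure]
    {g : E → ℝ} (hg : ∀ z, g (-z) = -g z) (x : E)
    (ε R : ℝ) : ∫ y in Metric.ball x R \ Metric.ball x ε, g (x - y) ∂μ = 0 := by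
  set G : E → ℝ := (Metric.ball 0 R \ Metric.ball 0 ε).indicator g with hG
  have hodd : ∀ z, G (-z) = -G z := fun z => by
    simp only [hG, indicator, Set.mem_sdiff, mem_ball_zero_iff, norm_neg, hg]
    split_ifs <;> simp_all
  have h1 : ∫ z, G z ∂μ = 0 := by
    have := integral_neg_eq_self G μ
    simp only [hodd, integral_neg] at this
    linarith
  rw [← integral_indicator
    (Metric.isOpen_ball.measurableSet.diff Metric.isOpen_ball.measurableSet), ← h1,
    ← integral_sub_left_eq_self G μ x]
  congr 1
  ext y
  simp [hG, indicator, dist_eq_norm', norm_sub_rev y x]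

/-! ### Geometry of the boundary and second-order expansion -/

/-- With a = L v > 0, moving by roughly tv increases φ by at least at, up to at/4 from the width of
the ball and at/4 from the linearisation error. Strict differentiability makes this uniform in the
base point z. -/
theorem HasStrictFDerivAt.exists_ball_add_lt {E : Type*} [NormedAddCommGroup E] [NormedSpace ℝ E]
    {φ : E → ℝ} {L : E →L[ℝ] ℝ} {x₀ : E} (h : HasStrictFDerivAt φ L x₀) (hL : L ≠ 0)
    {U : Set E} (hU : U ∈ 𝓝 x₀) :
    ∃ v : E, ‖v‖ = 1 ∧ ∃ κ : ℝ, 0 < κ ∧ κ ≤ 1 ∧ ∃ ρ : ℝ, 0 < ρ ∧ Metric.ball x₀ ρ ⊆ U ∧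
      ∀ z ∈ Metric.ball x₀ ρ, ∀ t : ℝ, 0 < t → t < ρ →
        ∀ y ∈ Metric.ball (z + t • v) (κ * t), y ∈ U ∧ φ z < φ y := by
  obtain ⟨v, hv, hLv⟩ : ∃ v : E, ‖v‖ = 1 ∧ 0 < L v := by
    obtain ⟨w, hw⟩ : ∃ w, L w ≠ 0 := by
      by_contra! hc
      exact hL (ContinuousLinearMap.ext fun w => hc w)
    obtain ⟨w, hw⟩ : ∃ w, 0 < L w := by
      rcases hw.lt_or_gt with hw | hw
      · exact ⟨-w, by simpa using hw⟩
      · exact ⟨w, hw⟩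
    have hw0 : w ≠ 0 := by rintro rfl; simp at hw
    have hn : 0 < ‖w‖ := norm_pos_iff.2 hw0
    refine ⟨‖w‖⁻¹ • w, ?_, ?_⟩
    · rw [norm_smul, norm_inv, norm_norm, inv_mul_cancel₀ hn.ne']
    · rw [map_smul, smul_eq_mul]; positivity
  set a := L v
  have hev := h.isLittleO.def (c := a / 8) (by positivity)
  rw [nhds_prod_eq] at hev
  obtain ⟨T, hT, hTe⟩ := (eventually_prod_self_iff
    (r := fun u w => ‖φ u - φ w - L (u - w)‖ ≤ a / 8 * ‖u - w‖)).1 hev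
  obtain ⟨R, hR, hRs⟩ := Metric.mem_nhds_iff.1 (inter_mem hU hT)
  refine ⟨v, hv, min 1 (a / (4 * (‖L‖ + 1))), by positivity, min_le_left _ _, R / 4, by positivity,
    (Metric.ball_subset_ball (by linarith)).trans (hRs.trans inter_subset_left), ?_⟩
  intro z hz t ht htR y hy
  set κ := min 1 (a / (4 * (‖L‖ + 1)))
  have hκ1 : κ ≤ 1 := min_le_left _ _
  have hκ2 : κ * (‖L‖ + 1) ≤ a / 4 := by
    have : κ ≤ a / (4 * (‖L‖ + 1)) := min_le_right _ _
    rw [le_div_iff₀ (by positivity)] at this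
    linarith
  rw [mem_ball_iff_norm] at hy
  have hyz : ‖y - z‖ ≤ 2 * t := by
    have e : y - z = (y - (z + t • v)) + t • v := by abel
    rw [e]
    refine (norm_add_le _ _).trans ?_
    rw [norm_smul, hv, Real.norm_of_nonneg ht.le]
    nlinarith
  have hzR : z ∈ Metric.ball x₀ R := Metric.ball_subset_ball (by linarith) hz
  have hyR : y ∈ Metric.ball x₀ R := by
    rw [mem_ball_iff_norm] at hz ⊢
    have := norm_sub_le_norm_sub_add_norm_sub y z x₀
    linarith
  refine ⟨(hRs hyR).1, ?_⟩
  have h1 := hTe y (hRs hyR).2 z (hRs hzR).2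
  have h2 : L (y - z) = L (y - (z + t • v)) + t * a := by
    have e : y - z = (y - (z + t • v)) + t • v := by abel
    rw [e, map_add, map_smul, smul_eq_mul]
  have h3 : |L (y - (z + t • v))| ≤ ‖L‖ * (κ * t) := by
    refine (L.le_opNorm _).trans ?_
    gcongr
  have h4 : ‖L‖ * (κ * t) ≤ a / 4 * t := by
    have : 0 < κ := by positivity
    nlinarith
  have h5 := abs_le.1 h3
  rw [Real.norm_eq_abs] at h1
  have h6 := abs_le.1 h1
  have h7 : a / 8 * ‖y - z‖ ≤ a / 8 * (2 * t) := by gcongr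
  have : 0 < a * t := by positivity
  linarith [h5.1, h6.1]

/-- A uniform exterior corkscrew condition for bounded open sets with `C²` boundary. -/
theorem HasC2Boundary.exists_exterior_balls {N : ℕ} {Ω : Set (EuclideanSpace ℝ (Fin N))}
    (hΩ2 : HasC2Boundary Ω) (hΩo : IsOpen Ω) (hΩb : Bornology.IsBounded Ω) :
    ∃ κ : ℝ, 0 < κ ∧ κ ≤ 1 ∧ ∃ t₀ : ℝ, 0 < t₀ ∧ ∀ z ∈ frontier Ω, ∀ t : ℝ, 0 < t → t < t₀ →
      ∃ v : EuclideanSpace ℝ (Fin N), ‖v‖ = 1 ∧ Metric.ball (z + t • v) (κ * t) ⊆ Ωᶜ := by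
  have hcpt : IsCompact (frontier Ω) :=
    Metric.isCompact_of_isClosed_isBounded isClosed_frontier
      (hΩb.closure.subset frontier_subset_closure)
  -- Compactness makes κ and t₀ uniform: a union of two pieces takes minima, so a local statement
  -- suffices.
  refine hcpt.induction_on (p := fun S => ∃ κ : ℝ, 0 < κ ∧ κ ≤ 1 ∧ ∃ t₀ : ℝ, 0 < t₀ ∧
    ∀ z ∈ S, ∀ t : ℝ, 0 < t → t < t₀ →
      ∃ v : EuclideanSpace ℝ (Fin N), ‖v‖ = 1 ∧ Metric.ball (z + t • v) (κ * t) ⊆ Ωᶜ) ?_ ?_ ?_ ?_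
  · exact ⟨1, one_pos, le_rfl, 1, one_pos, by simp⟩
  · rintro S T hST ⟨κ, hκ, hκ1, t₀, ht₀, h⟩
    exact ⟨κ, hκ, hκ1, t₀, ht₀, fun z hz => h z (hST hz)⟩
  · rintro S T ⟨κ, hκ, hκ1, t₀, ht₀, h⟩ ⟨κ', hκ', hκ1', t₀', ht₀', h'⟩
    refine ⟨min κ κ', lt_min hκ hκ', (min_le_left _ _).trans hκ1, min t₀ t₀', lt_min ht₀ ht₀', ?_⟩
    rintro z (hz | hz) t ht htt
    · obtain ⟨v, hv, hb⟩ := h z hz t ht (htt.trans_le (min_le_left _ _))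
      exact ⟨v, hv, (Metric.ball_subset_ball (by gcongr; exact min_le_left _ _)).trans hb⟩
    · obtain ⟨v, hv, hb⟩ := h' z hz t ht (htt.trans_le (min_le_right _ _))
      exact ⟨v, hv, (Metric.ball_subset_ball (by gcongr; exact min_le_right _ _)).trans hb⟩
  · intro x₀ hx₀
    obtain ⟨U, hUo, hxU, φ, hφ, hφ', hΩU⟩ := hΩ2 x₀ hx₀
    have hstrict := (hφ.contDiffAt (hUo.mem_nhds hxU)).hasStrictFDerivAt (by norm_num)
    obtain ⟨v, hv, κ, hκ, hκ1, ρ, hρ, hρU, h⟩ :=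
      hstrict.exists_ball_add_lt (hφ' x₀ hxU) (hUo.mem_nhds hxU)
    refine ⟨frontier Ω ∩ Metric.ball x₀ ρ, ?_, κ, hκ, hκ1, ρ, hρ, ?_⟩
    · exact inter_mem self_mem_nhdsWithin (mem_nhdsWithin_of_mem_nhds (Metric.ball_mem_nhds _ hρ))
    · rintro z ⟨hzf, hz⟩ t ht htρ
      refine ⟨v, hv, fun y hy hyΩ => ?_⟩
      obtain ⟨hyU, hlt⟩ := h z hz t ht htρ y hy
      -- A point of Ω in the ball would force φ z < φ y < 0, hence z ∈ Ω, impossible for a frontier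
      -- point of an open set.
      have hy0 : φ y < 0 := ((hΩU.subset ⟨hyΩ, hyU⟩ : y ∈ {x ∈ U | φ x < 0})).2
      have hzΩ : z ∈ Ω := (hΩU.superset ⟨hρU hz, hlt.trans hy0⟩ : z ∈ Ω ∩ U).1
      rw [hΩo.frontier_eq] at hzf
      exact hzf.2 hzΩ

/-- The derivative is locally Lipschitz; the mean value inequality on the closed ball of radius ‖y -
x‖ supplies the second factor. -/
theorem ContDiffAt.exists_quadratic_bound {E : Type*} [NormedAddCommGroup E] [NormedSpace ℝ E]
    {f : E → ℝ} {x : E} (h : ContDiffAt ℝ 2 f x) :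
    ∃ K : ℝ, 0 ≤ K ∧ ∃ ρ : ℝ, 0 < ρ ∧ ∀ y ∈ Metric.ball x ρ,
      |f y - f x - fderiv ℝ f x (y - x)| ≤ K * ‖y - x‖ ^ 2 := by
  obtain ⟨K, T, hT, hlip⟩ := (h.fderiv_right (m := 1) (by norm_num)).exists_lipschitzOnWith
  have hd : ∀ᶠ y in 𝓝 x, DifferentiableAt ℝ f y :=
    (h.eventually (by simp)).mono fun y hy => hy.differentiableAt (by norm_num)
  obtain ⟨ρ, hρ, hs⟩ := Metric.mem_nhds_iff.1 (inter_mem hT hd)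
  refine ⟨K, K.2, ρ, hρ, fun y hy => ?_⟩
  have hsub : Metric.closedBall x ‖y - x‖ ⊆ Metric.ball x ρ :=
    Metric.closedBall_subset_ball (mem_ball_iff_norm.1 hy)
  have := (convex_closedBall x ‖y - x‖).norm_image_sub_le_of_norm_hasFDerivWithin_le'
    (f := f) (f' := fderiv ℝ f) (φ := fderiv ℝ f x) (C := K * ‖y - x‖) (x := x) (y := y)
    (fun w hw => (hs (hsub hw)).2.hasFDerivAt.hasFDerivWithinAt)
    (fun w hw => (hlip.norm_sub_le (hs (hsub hw)).1 (mem_of_mem_nhds hT)).trans (by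
      have := mem_closedBall_iff_norm.1 hw
      gcongr))
    (Metric.mem_closedBall_self (norm_nonneg _)) (mem_closedBall_iff_norm.2 le_rfl)
  rw [Real.norm_eq_abs] at this
  linarith

theorem ball_infDist_frontier_subset {E : Type*} [NormedAddCommGroup E] [NormedSpace ℝ E]
    [FiniteDimensional ℝ E] {Ω : Set E} {x : E} (hx : x ∈ Ω) :
    Metric.ball x (Metric.infDist x (frontier Ω)) ⊆ Ω := by
  intro y hy
  by_contra hyΩ
  obtain ⟨w, hw, hwd⟩ := exists_mem_frontier_infDist_compl_eq_dist hx
    (fun h : Ω = univ => hyΩ (h ▸ mem_univ y))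
  have h1 := Metric.infDist_le_dist_of_mem (x := x) hw
  have h2 := Metric.infDist_le_dist_of_mem (x := x) (mem_compl hyΩ)
  rw [Metric.mem_ball, dist_comm] at hy
  linarith

/-! ### Principal value: existence and lower bounds near the singularity -/

theorem fracPLapIntegrand_eq {N : ℕ} (s p : ℝ) (u : EuclideanSpace ℝ (Fin N) → ℝ)
    (x y : EuclideanSpace ℝ (Fin N)) :
    fracPLapIntegrand s p u x y = oddPow p (u x - u y) / ‖x - y‖ ^ ((N : ℝ) + s * p) := rfl

/-- Equality can fail only at w = 0, where the left side is 0 but the right side is 1 if a = b. -/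
theorem rpow_div_rpow_le {w a b : ℝ} (hw : 0 ≤ w) (ha : a ≠ 0) : w ^ a / w ^ b ≤ w ^ (a - b) := by
  rcases hw.eq_or_lt with rfl | hw
  · rw [Real.zero_rpow ha, zero_div]
    exact Real.rpow_nonneg le_rfl _
  · rw [Real.rpow_sub hw]

theorem one_div_rpow_eq {w : ℝ} (hw : 0 ≤ w) (n b : ℝ) : 1 / w ^ (n + b) = w ^ (-b - n) := by
  rw [one_div, ← Real.rpow_neg hw]
  ring_nf

section

variable {N : ℕ} {s p : ℝ}

theorem integrableOn_div_rpow [NeZero N] (hsp : 0 < s * p) {g : EuclideanSpace ℝ (Fin N) → ℝ}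
    (hg : Measurable g) {B : ℝ} {x : EuclideanSpace ℝ (Fin N)} {ε : ℝ} (hε : 0 < ε)
    {S : Set (EuclideanSpace ℝ (Fin N))} (hS : MeasurableSet S) (hSε : S ⊆ (Metric.ball x ε)ᶜ)
    (hB : ∀ y ∈ S, |g y| ≤ B) :
    IntegrableOn (fun y => g y / ‖x - y‖ ^ ((N : ℝ) + s * p)) S := by
  have h := ((integrableOn_compl_ball_rpow volume x hε hsp).mono_set hSε).const_mul B
  rw [finrank_euclideanSpace_fin] at h
  refine Integrable.mono' h
    (hg.div (by fun_prop : Measurable fun y => ‖x - y‖ ^ ((N : ℝ) + s * p))).aestronglyMeasurable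
     ((ae_restrict_iff' hS).2 (ae_of_all _ fun y hy => ?_))
  rw [← one_div_rpow_eq (norm_nonneg _), mul_one_div, Real.norm_eq_abs, abs_div,
    abs_of_nonneg (Real.rpow_nonneg (norm_nonneg (x - y)) _)]
  gcongr
  exact hB y hy

theorem integrableOn_fracPLapIntegrand [NeZero N] (hp : 1 < p) (hsp : 0 < s * p)
    {u : EuclideanSpace ℝ (Fin N) → ℝ} (hu : Measurable u) {B : ℝ} (hB : ∀ y, |u y| ≤ B)
    (x : EuclideanSpace ℝ (Fin N)) {ε : ℝ} (hε : 0 < ε) :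
    IntegrableOn (fracPLapIntegrand s p u x) (Metric.ball x ε)ᶜ := by
  refine integrableOn_div_rpow (g := fun y => oddPow p (u x - u y)) (B := (2 * B) ^ (p - 1)) hsp
    ((measurable_oddPow p).comp (measurable_const.sub hu)) hε
    Metric.isOpen_ball.measurableSet.compl Subset.rfl fun y _ => ?_
  rw [abs_oddPow hp]
  refine Real.rpow_le_rpow (abs_nonneg _) ((abs_sub _ _).trans ?_) (by linarith)
  linarith [hB x, hB y]

theorem fracPLapTrunc_eq_add {u : EuclideanSpace ℝ (Fin N) → ℝ} {x : EuclideanSpace ℝ (Fin N)}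
    {ε R : ℝ} (hεR : ε ≤ R)
    (hF : IntegrableOn (fracPLapIntegrand s p u x) (Metric.ball x ε)ᶜ) :
    fracPLapTrunc s p u x ε =
      2 * ((∫ y in Metric.ball x R \ Metric.ball x ε, fracPLapIntegrand s p u x y) +
        ∫ y in (Metric.ball x R)ᶜ, fracPLapIntegrand s p u x y) := by
  have hsub : Metric.ball x ε ⊆ Metric.ball x R := Metric.ball_subset_ball hεR
  have hc : (Metric.ball x ε)ᶜ = (Metric.ball x R \ Metric.ball x ε) ∪ (Metric.ball x R)ᶜ := by
    ext y
    have := @hsub y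
    simp only [mem_compl_iff, mem_union, Set.mem_sdiff]
    tauto
  rw [fracPLapTrunc, hc, setIntegral_union
    (disjoint_compl_right.mono_left sdiff_subset)
    Metric.isOpen_ball.measurableSet.compl (hF.mono_set fun y hy => hy.2)
    (hF.mono_set (compl_subset_compl.2 hsub))]

theorem integrableOn_annulus_oddPow_linear [NeZero N] (hp : 1 < p) (hsp : 0 < s * p)
    (ℓ : EuclideanSpace ℝ (Fin N) →L[ℝ] ℝ) (x : EuclideanSpace ℝ (Fin N)) {ε : ℝ} (hε : 0 < ε)
    (R : ℝ) : IntegrableOn (fun y => oddPow p (ℓ (x - y)) / ‖x - y‖ ^ ((N : ℝ) + s * p))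
      (Metric.ball x R \ Metric.ball x ε) := by
  refine integrableOn_div_rpow (g := fun y => oddPow p (ℓ (x - y)))
    (B := (‖ℓ‖ * R) ^ (p - 1)) hsp ((measurable_oddPow p).comp (by fun_prop)) hε
    (Metric.isOpen_ball.measurableSet.diff Metric.isOpen_ball.measurableSet)
    (fun y hy => hy.2) fun y hy => ?_
  rw [abs_oddPow hp]
  refine Real.rpow_le_rpow (abs_nonneg _) ((ℓ.le_opNorm _).trans ?_) (by linarith)
  have := hy.1
  rw [mem_ball_iff_norm'] at this
  gcongr

theorem integral_annulus_oddPow_linear (ℓ : EuclideanSpace ℝ (Fin N) →L[ℝ] ℝ)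
    (x : EuclideanSpace ℝ (Fin N)) (ε R : ℝ) :
    ∫ y in Metric.ball x R \ Metric.ball x ε,
      oddPow p (ℓ (x - y)) / ‖x - y‖ ^ ((N : ℝ) + s * p) = 0 :=
  integral_annulus_eq_zero_of_odd volume
    (g := fun z => oddPow p (ℓ z) / ‖z‖ ^ ((N : ℝ) + s * p))
    (fun z => by rw [map_neg, oddPow_neg, norm_neg, neg_div]) x ε R

/-- The principal value exists at points where a bounded measurable function is `C²`. -/
theorem fracPLapExists_of_contDiffAt [NeZero N] (hp : 1 < p) (hsp : 0 < s * p)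
    (hsp' : s * p < min p (2 * (p - 1))) {u : EuclideanSpace ℝ (Fin N) → ℝ} (hu : Measurable u)
    {B : ℝ} (hB : ∀ y, |u y| ≤ B) {x : EuclideanSpace ℝ (Fin N)} (hx : ContDiffAt ℝ 2 u x) :
    FracPLapExists s p u x := by
  have hF : ∀ ε : ℝ, 0 < ε → IntegrableOn (fracPLapIntegrand s p u x) (Metric.ball x ε)ᶜ :=
    fun ε hε => integrableOn_fracPLapIntegrand hp hsp hu hB x hε
  refine ⟨hF, ?_⟩
  obtain ⟨K, hK, ρ, hρ, hq⟩ := hx.exists_quadratic_bound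
  obtain ⟨C, hC, hJ⟩ := exists_abs_oddPow_add_sub_le hp
  set σ := min p (2 * (p - 1)) with hσ
  have hσ0 : 0 < σ := hsp.trans hsp'
  set ℓ := fderiv ℝ u x
  set R := min 1 ρ with hR
  have hR0 : 0 < R := by positivity
  set A := ‖ℓ‖ + K with hA
  set k : ℝ := (N : ℝ) + s * p with hk
  set H : EuclideanSpace ℝ (Fin N) → ℝ := fun y => oddPow p (ℓ (x - y)) / ‖x - y‖ ^ k with hH
  -- Removing the odd linear contribution leaves an absolutely integrable function near `x`.
  set G : EuclideanSpace ℝ (Fin N) → ℝ := fun y => fracPLapIntegrand s p u x y - H y with hG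
  set D := C * A ^ (p - 1) with hD
  have hGb : ∀ y ∈ Metric.ball x R, ‖G y‖ ≤ D * ‖x - y‖ ^ (σ - s * p - N) := fun y hy => by
    have hyn := mem_ball_iff_norm'.1 hy
    have h1 := hJ A ‖x - y‖ (ℓ (x - y)) (-(u y - u x - ℓ (y - x))) (by positivity)
      (norm_nonneg _) (hyn.le.trans (min_le_left _ _))
      ((ℓ.le_opNorm _).trans (by gcongr; linarith))
      (by
        rw [abs_neg, norm_sub_rev]
        refine (hq y (Metric.ball_subset_ball (min_le_right _ _) hy)).trans ?_
        gcongr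
        linarith [norm_nonneg ℓ])
    have e : ℓ (x - y) + -(u y - u x - ℓ (y - x)) = u x - u y := by
      rw [map_sub, map_sub]; ring
    rw [e] at h1
    have h2 : G y = (oddPow p (u x - u y) - oddPow p (ℓ (x - y))) / ‖x - y‖ ^ k := by
      simp only [hG, hH, fracPLapIntegrand_eq, sub_div, hk]
    rw [h2, Real.norm_eq_abs, abs_div, abs_of_nonneg (Real.rpow_nonneg (norm_nonneg (x - y)) _)]
    calc _ ≤ D * ‖x - y‖ ^ σ / ‖x - y‖ ^ k := by gcongr
      _ = D * (‖x - y‖ ^ σ / ‖x - y‖ ^ k) := by ring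
      _ ≤ D * ‖x - y‖ ^ (σ - k) := by
        gcongr
        exact rpow_div_rpow_le (norm_nonneg _) hσ0.ne'
      _ = _ := by rw [hk]; ring_nf
  have hGm : Measurable G := by
    have h1 := measurable_oddPow p
    simp only [hG, hH, fracPLapIntegrand_eq]
    fun_prop
  have hb : 0 < σ - s * p := by linarith
  have hpow : ∀ r : ℝ, IntegrableOn (fun y => D * ‖x - y‖ ^ (σ - s * p - N))
      (Metric.ball x r) := fun r => by
    have := (integrableOn_ball_rpow (R := r) volume x hb).const_mul D
    rwa [finrank_euclideanSpace_fin] at this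
  have hGi : IntegrableOn G (Metric.ball x R) :=
    Integrable.mono' (hpow R) hGm.aestronglyMeasurable
      ((ae_restrict_iff' Metric.isOpen_ball.measurableSet).2 (ae_of_all _ hGb))
  set c : ℝ := D * (N * volume.real (Metric.ball (0 : EuclideanSpace ℝ (Fin N)) 1) /
    (σ - s * p)) with hc
  have hsmall : ∀ ε : ℝ, 0 < ε → ε ≤ R → ‖∫ y in Metric.ball x ε, G y‖ ≤ c * ε ^ (σ - s * p) :=
    fun ε hε hεR => by
      have h1 := norm_integral_le_of_norm_le (hpow ε)
        ((ae_restrict_iff' Metric.isOpen_ball.measurableSet).2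
          (ae_of_all _ fun y hy => hGb y (Metric.ball_subset_ball hεR hy)))
      have h2 := integral_ball_rpow volume x hε hb
      rw [finrank_euclideanSpace_fin] at h2
      rw [integral_const_mul, h2, ← mul_assoc] at h1
      exact h1
  -- The linear part vanishes on the annulus, so ε enters only through the integral of `G` over the
  -- small ball, which tends to 0.
  have htr : ∀ ε : ℝ, 0 < ε → ε ≤ R → fracPLapTrunc s p u x ε =
      2 * ((∫ y in Metric.ball x R, G y) - (∫ y in Metric.ball x ε, G y) +
        ∫ y in (Metric.ball x R)ᶜ, fracPLapIntegrand s p u x y) := fun ε hε hεR => by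
    have hsub : Metric.ball x ε ⊆ Metric.ball x R := Metric.ball_subset_ball hεR
    have hFa : IntegrableOn (fracPLapIntegrand s p u x) (Metric.ball x R \ Metric.ball x ε) :=
      (hF ε hε).mono_set fun y hy => hy.2
    have hHa := integrableOn_annulus_oddPow_linear hp hsp ℓ x hε R
    have h1 : ∫ y in Metric.ball x R \ Metric.ball x ε, G y =
        ∫ y in Metric.ball x R \ Metric.ball x ε, fracPLapIntegrand s p u x y := by
      rw [hG, integral_sub hFa hHa, integral_annulus_oddPow_linear, sub_zero]
    rw [fracPLapTrunc_eq_add hεR (hF ε hε), ← h1,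
      setIntegral_sdiff Metric.isOpen_ball.measurableSet hGi hsub]
  refine ⟨2 * ((∫ y in Metric.ball x R, G y) - 0 +
        ∫ y in (Metric.ball x R)ᶜ, fracPLapIntegrand s p u x y), ?_⟩
  have hev : ∀ᶠ ε : ℝ in 𝓝[>] 0, 0 < ε ∧ ε ≤ R :=
    Filter.Eventually.and self_mem_nhdsWithin
      (eventually_nhdsWithin_of_eventually_nhds (eventually_le_nhds hR0))
  refine Tendsto.congr' (hev.mono fun ε hε => (htr ε hε.1 hε.2).symm) ?_
  refine ((tendsto_const_nhds.sub ?_).add_const _).const_mul 2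
  refine squeeze_zero_norm' (hev.mono fun ε hε => hsmall ε hε.1 hε.2) ?_
  have h0 : Tendsto (fun ε : ℝ => c * ε ^ (σ - s * p)) (𝓝 0) (𝓝 (c * 0 ^ (σ - s * p))) :=
    ((Real.continuous_rpow_const hb.le).tendsto 0).const_mul c
  rw [Real.zero_rpow hb.ne', mul_zero] at h0
  exact h0.mono_left nhdsWithin_le_nhds

/-- A function lying below a paraboloid at `x` has annular integrals bounded from below
independently of the inner radius. -/
theorem exists_neg_le_integral_annulus [NeZero N] (hp : 1 < p) (hsp : 0 < s * p)
    (hsp' : s * p < min p (2 * (p - 1))) :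
    ∃ C : ℝ, 0 ≤ C ∧ ∀ (u : EuclideanSpace ℝ (Fin N) → ℝ) (x : EuclideanSpace ℝ (Fin N))
      (ε R A : ℝ) (ℓ : EuclideanSpace ℝ (Fin N) →L[ℝ] ℝ), 0 < ε → 0 < R → 0 ≤ A →
      IntegrableOn (fracPLapIntegrand s p u x) (Metric.ball x ε)ᶜ →
      (∀ y ∈ Metric.ball x R, ℓ (x - y) - A * (‖x - y‖ / R) ^ 2 ≤ u x - u y) →
      (∀ w, |ℓ w| ≤ A * (‖w‖ / R)) →
      -(C * A ^ (p - 1) * R ^ (-(s * p))) ≤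
        ∫ y in Metric.ball x R \ Metric.ball x ε, fracPLapIntegrand s p u x y := by
  obtain ⟨C, hC, hJ⟩ := exists_abs_oddPow_add_sub_le hp
  set σ := min p (2 * (p - 1)) with hσ
  have hσ0 : 0 < σ := hsp.trans hsp'
  have hb : 0 < σ - s * p := by linarith
  set ω : ℝ := N * volume.real (Metric.ball (0 : EuclideanSpace ℝ (Fin N)) 1) / (σ - s * p) with hω
  refine ⟨C * ω, by positivity, fun u x ε R A ℓ hε hR hA hF hu hℓ => ?_⟩
  set k : ℝ := (N : ℝ) + s * p with hk
  set D := C * A ^ (p - 1) * R ^ (-σ) with hD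
  have hD0 : 0 ≤ D := by positivity
  have hpow : ∀ r : ℝ, IntegrableOn (fun y => D * ‖x - y‖ ^ (σ - s * p - N))
      (Metric.ball x r) := fun r => by
    have := (integrableOn_ball_rpow (R := r) volume x hb).const_mul D
    rwa [finrank_euclideanSpace_fin] at this
  have hHa := integrableOn_annulus_oddPow_linear hp hsp ℓ x hε R
  have hFa : IntegrableOn (fracPLapIntegrand s p u x) (Metric.ball x R \ Metric.ball x ε) :=
    hF.mono_set fun y hy => hy.2
  have hPa := (hpow R).mono_set (sdiff_subset (t := Metric.ball x ε))
  have hpt : ∀ y ∈ Metric.ball x R \ Metric.ball x ε,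
      oddPow p (ℓ (x - y)) / ‖x - y‖ ^ k - D * ‖x - y‖ ^ (σ - s * p - N) ≤
        fracPLapIntegrand s p u x y := fun y hy => by
    have hyn := mem_ball_iff_norm'.1 hy.1
    have ht : ‖x - y‖ / R ≤ 1 := (div_le_one hR).2 hyn.le
    have h1 := hJ A (‖x - y‖ / R) (ℓ (x - y)) (-(A * (‖x - y‖ / R) ^ 2)) hA (by positivity) ht
      (hℓ _) (by rw [abs_neg, abs_of_nonneg (by positivity)])
    -- Monotonicity makes a one-sided comparison with the paraboloid enough for a lower bound.
    have h2 := monotone_oddPow hp (hu y hy.1)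
    have h3 := (abs_le.1 h1).1
    rw [← sub_eq_add_neg] at h3
    have h4 : C * A ^ (p - 1) * (‖x - y‖ / R) ^ σ = D * ‖x - y‖ ^ σ := by
      rw [Real.div_rpow (norm_nonneg _) hR.le, hD, Real.rpow_neg hR.le]
      ring
    rw [h4] at h3
    rw [fracPLapIntegrand_eq]
    calc _ ≤ oddPow p (ℓ (x - y)) / ‖x - y‖ ^ k - D * (‖x - y‖ ^ σ / ‖x - y‖ ^ k) := by
          gcongr
          refine (rpow_div_rpow_le (norm_nonneg _) hσ0.ne').trans_eq ?_
          rw [hk]; ring_nf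
      _ = (oddPow p (ℓ (x - y)) - D * ‖x - y‖ ^ σ) / ‖x - y‖ ^ k := by ring
      _ ≤ _ := by
          gcongr
          linarith
  have h1 := setIntegral_mono_on (hHa.sub hPa) hFa
    (Metric.isOpen_ball.measurableSet.diff Metric.isOpen_ball.measurableSet) hpt
  refine le_trans ?_ h1
  have h2 : ∫ y in Metric.ball x R \ Metric.ball x ε,
      (oddPow p (ℓ (x - y)) / ‖x - y‖ ^ k - D * ‖x - y‖ ^ (σ - s * p - N)) =
      0 - ∫ y in Metric.ball x R \ Metric.ball x ε, D * ‖x - y‖ ^ (σ - s * p - N) := by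
    rw [integral_sub hHa hPa, integral_annulus_oddPow_linear]
  have h3 : ∫ y in Metric.ball x R \ Metric.ball x ε, D * ‖x - y‖ ^ (σ - s * p - N) ≤
      ∫ y in Metric.ball x R, D * ‖x - y‖ ^ (σ - s * p - N) :=
    setIntegral_mono_set (hpow R)
      (ae_of_all _ fun y => mul_nonneg hD0 (Real.rpow_nonneg (norm_nonneg _) _))
      (LE.le.eventuallyLE sdiff_subset)
  have h4 := integral_ball_rpow volume x hR hb
  rw [finrank_euclideanSpace_fin] at h4
  simp only [integral_const_mul] at h2 h3
  rw [h4, ← hω] at h3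
  have h5 : D * (ω * R ^ (σ - s * p)) = C * ω * A ^ (p - 1) * R ^ (-(s * p)) := by
    have : R ^ (-(s * p)) = R ^ (-σ) * R ^ (σ - s * p) := by
      rw [← Real.rpow_add hR]; ring_nf
    rw [hD, this]
    ring
  refine le_trans ?_ h2.symm.le
  linarith

end

/-! ### Pointwise and integral bounds for barriers -/

/-- Bernoulli for the exponent β/γ ≤ 1 applied to T^γ. The excess over 1 gains a factor β while its
growth in T is independent of β. -/
theorem rpow_le_one_add_div_mul_rpow {T β γ : ℝ} (hT : 1 ≤ T) (hβ : 0 < β) (hβγ : β ≤ γ) :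
    T ^ β ≤ 1 + β / γ * T ^ γ := by
  have hγ : 0 < γ := hβ.trans_le hβγ
  have hTγ : 0 ≤ T ^ γ := by positivity
  have h := rpow_one_add_le_one_add_mul_self (s := T ^ γ - 1) (by linarith) (p := β / γ)
    (by positivity) ((div_le_one hγ).2 hβγ)
  rw [add_sub_cancel, ← Real.rpow_mul (by linarith), mul_div_cancel₀ _ hγ.ne'] at h
  have : 0 < β / γ := by positivity
  linarith

/-- Writing ‖n - w‖² = ‖n‖²(1 + 2τ), one has √(1 + 2τ) ≤ 1 + τ and (1 + τ)^β ≤ 1 + βτ. Both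
coefficients of the resulting paraboloid keep the factor β‖n‖^β. -/
theorem norm_sub_rpow_le {E : Type*} [NormedAddCommGroup E] [InnerProductSpace ℝ E] {n w : E}
    {β : ℝ} (hn : n ≠ 0) (hβ : 0 ≤ β) (hβ1 : β ≤ 1) :
    ‖n - w‖ ^ β ≤
      ‖n‖ ^ β - (β * ‖n‖ ^ β / ‖n‖ ^ 2 * inner ℝ n w - β * ‖n‖ ^ β * (‖w‖ / ‖n‖) ^ 2) := by
  have hn0 : 0 < ‖n‖ := norm_pos_iff.2 hn
  set τ := (‖w‖ ^ 2 - 2 * inner ℝ n w) / (2 * ‖n‖ ^ 2) with hτ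
  have h1 : ‖n - w‖ ^ 2 = ‖n‖ ^ 2 * (1 + 2 * τ) := by
    rw [@norm_sub_sq_real, hτ]; field_simp; ring
  have h2 : 0 ≤ 1 + 2 * τ := by
    by_contra! h
    have : ‖n‖ ^ 2 * (1 + 2 * τ) < 0 := mul_neg_of_pos_of_neg (by positivity) h
    linarith [sq_nonneg ‖n - w‖]
  have h3 : ‖n - w‖ ≤ ‖n‖ * (1 + τ) := by
    refine le_of_sq_le_sq ?_ (mul_nonneg hn0.le (by linarith))
    rw [h1, mul_pow]
    gcongr
    nlinarith [sq_nonneg τ]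
  have h4 : ‖n - w‖ ^ β ≤ ‖n‖ ^ β * (1 + β * τ) := by
    refine (Real.rpow_le_rpow (norm_nonneg _) h3 hβ).trans ?_
    rw [Real.mul_rpow hn0.le (by linarith)]
    gcongr
    exact rpow_one_add_le_one_add_mul_self (by linarith) hβ hβ1
  have h5 : ‖n‖ ^ β * (1 + β * τ) = ‖n‖ ^ β - (β * ‖n‖ ^ β / ‖n‖ ^ 2 * inner ℝ n w -
      β * ‖n‖ ^ β * (‖w‖ / ‖n‖) ^ 2) - β * ‖n‖ ^ β * (‖w‖ / ‖n‖) ^ 2 / 2 := by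
    rw [hτ]; field_simp; ring
  have h6 : 0 ≤ β * ‖n‖ ^ β * (‖w‖ / ‖n‖) ^ 2 / 2 := by positivity
  linarith

section

variable {N : ℕ} {s p : ℝ} {Ω : Set (EuclideanSpace ℝ (Fin N))} {δ₀ β : ℝ}
  {ξ : EuclideanSpace ℝ (Fin N) → ℝ}

theorem IsBarrier.nonneg (h : IsBarrier Ω δ₀ β ξ) (x : EuclideanSpace ℝ (Fin N)) : 0 ≤ ξ x := by
  by_cases hx : x ∈ Ω
  · exact (h.pos x hx).le
  · exact (h.eq_zero x hx).ge

theorem IsBarrier.measurable (h : IsBarrier Ω δ₀ β ξ) (hΩo : IsOpen Ω) : Measurable ξ := by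
  classical
  have h1 : Measurable (Ω.piecewise ξ 0) :=
    h.contDiffOn.continuousOn.measurable_piecewise continuousOn_const hΩo.measurableSet
  convert h1 using 1
  ext x
  by_cases hx : x ∈ Ω
  · simp [hx]
  · simp [hx, h.eq_zero x hx]

theorem IsBarrier.le_rpow_norm_sub (h : IsBarrier Ω δ₀ β ξ) (hβ : 0 ≤ β)
    {y z : EuclideanSpace ℝ (Fin N)} (hz : z ∈ frontier Ω) (hy : y ∈ Ω → bdryDist Ω y < δ₀) :
    ξ y ≤ ‖y - z‖ ^ β := by
  by_cases hyΩ : y ∈ Ω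
  · rw [h.eq_strip y ⟨hyΩ, hy hyΩ⟩, ← dist_eq_norm]
    exact Real.rpow_le_rpow Metric.infDist_nonneg (Metric.infDist_le_dist_of_mem hz) hβ
  · rw [h.eq_zero y hyΩ]
    positivity

/-- Near a point `x` of the strip, a barrier lies below a paraboloid touching it at `x`. -/
theorem IsBarrier.exists_paraboloid (h : IsBarrier Ω δ₀ β ξ) (hβ : 0 ≤ β) (hβ1 : β ≤ 1)
    {x z : EuclideanSpace ℝ (Fin N)} (hx : x ∈ Ω) (hz : z ∈ frontier Ω)
    (hxz : bdryDist Ω x = ‖x - z‖) (hr : 0 < bdryDist Ω x) (hrδ : 2 * bdryDist Ω x ≤ δ₀) :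
    ∃ ℓ : EuclideanSpace ℝ (Fin N) →L[ℝ] ℝ,
      (∀ w, |ℓ w| ≤ β * bdryDist Ω x ^ β * (‖w‖ / bdryDist Ω x)) ∧
      ∀ y ∈ Metric.ball x (bdryDist Ω x),
        ℓ (x - y) - β * bdryDist Ω x ^ β * (‖x - y‖ / bdryDist Ω x) ^ 2 ≤ ξ x - ξ y := by
  set r := bdryDist Ω x with hrdef
  -- This is the derivative at `x` of |· - z|^β.
  refine ⟨(β * r ^ β / r ^ 2) • innerSL ℝ (x - z), fun w => ?_, fun y hy => ?_⟩
  · rw [_root_.smul_apply, innerSL_apply_apply, smul_eq_mul, abs_mul,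
      abs_of_nonneg (by positivity)]
    calc _ ≤ β * r ^ β / r ^ 2 * (‖x - z‖ * ‖w‖) := by
          gcongr
          exact abs_real_inner_le_norm _ _
      _ = _ := by rw [← hxz]; field_simp
  · have hn : x - z ≠ 0 := by
      rw [← norm_pos_iff, ← hxz]; exact hr
    have h1 := norm_sub_rpow_le (w := x - y) hn hβ hβ1
    have h2 : ξ y ≤ ‖y - z‖ ^ β := h.le_rpow_norm_sub hβ hz fun _ => by
      have h3 : bdryDist Ω y ≤ ‖y - z‖ := by
        rw [← dist_eq_norm]; exact Metric.infDist_le_dist_of_mem hz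
      have h4 := norm_sub_le_norm_sub_add_norm_sub y x z
      rw [mem_ball_iff_norm] at hy
      linarith
    have h5 : ξ x = r ^ β := h.eq_strip x ⟨hx, by linarith⟩
    rw [sub_sub_sub_cancel_left, ← hxz] at h1
    rw [_root_.smul_apply, innerSL_apply_apply, smul_eq_mul, h5]
    linarith

/-- The exponent γ = sp/(2(p-1)) turns (T^γ)^(p-1) into T^(sp/2), using up half of the kernel's
decay. A point of Ω with d ≥ δ₀ is at distance at least δ₀/2 from `x`, so the crude bound by M is
confined to the indicator term. -/
theorem IsBarrier.neg_le_integrand (h : IsBarrier Ω δ₀ β ξ) (hp : 1 < p) (hsp : 0 < s * p)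
    (hβ : 0 < β) (hβγ : β ≤ s * p / (2 * (p - 1))) {M : ℝ} (hM : ∀ y, ξ y ≤ M)
    {x z y : EuclideanSpace ℝ (Fin N)} (hx : x ∈ Ω) (hz : z ∈ frontier Ω)
    (hxz : bdryDist Ω x = ‖x - z‖) (hr : 0 < bdryDist Ω x) (hrδ : 2 * bdryDist Ω x ≤ δ₀)
    (hy : bdryDist Ω x ≤ ‖x - y‖) :
    -((bdryDist Ω x ^ β) ^ (p - 1) * (β / (s * p / (2 * (p - 1)))) ^ (p - 1) *
        (2 / bdryDist Ω x) ^ (s * p / 2) * ‖x - y‖ ^ (-(s * p / 2) - N)) -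
      (Metric.ball x (δ₀ / 2))ᶜ.indicator (fun y => M ^ (p - 1) * ‖x - y‖ ^ (-(s * p) - N)) y ≤
      fracPLapIntegrand s p ξ x y := by
  set r := bdryDist Ω x with hrdef
  set γ := s * p / (2 * (p - 1)) with hγ
  have hp1 : 0 < p - 1 := by linarith
  have hγ0 : 0 < γ := by positivity
  have hM0 : 0 ≤ M := (h.nonneg x).trans (hM x)
  have hw : 0 < ‖x - y‖ := hr.trans_le hy
  have hyz : bdryDist Ω y ≤ ‖y - z‖ := by
    rw [← dist_eq_norm]; exact Metric.infDist_le_dist_of_mem hz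
  have hyz2 : ‖y - z‖ ≤ ‖x - y‖ + r := by
    have := norm_sub_le_norm_sub_add_norm_sub y x z
    rwa [norm_sub_rev y x, ← hxz] at this
  have hind : 0 ≤ (Metric.ball x (δ₀ / 2))ᶜ.indicator
      (fun y => M ^ (p - 1) * ‖x - y‖ ^ (-(s * p) - N)) y :=
    indicator_nonneg (fun y _ => by positivity) y
  rw [fracPLapIntegrand_eq]
  by_cases hy' : y ∈ Ω → bdryDist Ω y < δ₀
  -- Here ‖y - z‖ ≤ ‖x - y‖ + r ≤ 2‖x - y‖ = rT.
  · set T := 2 * ‖x - y‖ / r with hT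
    have hT1 : 1 ≤ T := (one_le_div hr).2 (by linarith)
    have h1 : ξ y ≤ (r * T) ^ β :=
      (h.le_rpow_norm_sub hβ.le hz hy').trans
        (Real.rpow_le_rpow (norm_nonneg _) (by rw [hT, mul_div_cancel₀ _ hr.ne']; linarith) hβ.le)
    have h2 : ξ y ≤ r ^ β * (1 + β / γ * T ^ γ) := by
      refine h1.trans ?_
      rw [Real.mul_rpow hr.le (by linarith)]
      gcongr
      exact rpow_le_one_add_div_mul_rpow hT1 hβ hβγ
    have h5 : ξ x = r ^ β := h.eq_strip x ⟨hx, by linarith⟩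
    have h6 : -(r ^ β * (β / γ * T ^ γ)) ≤ ξ x - ξ y := by rw [h5]; linarith
    have h7 := monotone_oddPow hp h6
    have hT0 : 0 ≤ T := by linarith
    have h8 : (T ^ γ) ^ (p - 1) = (2 / r) ^ (s * p / 2) * ‖x - y‖ ^ (s * p / 2) := by
      rw [← Real.rpow_mul hT0, ← Real.mul_rpow (by positivity) hw.le]
      congr 1
      · rw [hT]; ring
      · rw [hγ]; field_simp
    rw [oddPow_neg_of_nonneg hp (by positivity), Real.mul_rpow (by positivity) (by positivity),
      Real.mul_rpow (by positivity) (by positivity), h8] at h7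
    have h9 : ‖x - y‖ ^ (-(s * p / 2) - N) =
        ‖x - y‖ ^ (s * p / 2) / ‖x - y‖ ^ ((N : ℝ) + s * p) := by
      rw [← Real.rpow_sub hw]; ring_nf
    rw [h9]
    refine (sub_le_self _ hind).trans ?_
    calc _ = -((r ^ β) ^ (p - 1) * ((β / γ) ^ (p - 1) *
            ((2 / r) ^ (s * p / 2) * ‖x - y‖ ^ (s * p / 2)))) / ‖x - y‖ ^ ((N : ℝ) + s * p) := by
          ring
      _ ≤ _ := by gcongr
  · push Not at hy'
    have hyb : y ∈ (Metric.ball x (δ₀ / 2))ᶜ := by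
      rw [mem_compl_iff, mem_ball_iff_norm', not_lt]
      linarith
    rw [indicator_of_mem hyb]
    have h6 : -M ≤ ξ x - ξ y := by linarith [hM y, h.nonneg x]
    have h7 := monotone_oddPow hp h6
    rw [oddPow_neg_of_nonneg hp hM0] at h7
    have h8 : 0 ≤ (r ^ β) ^ (p - 1) * (β / γ) ^ (p - 1) *
        (2 / r) ^ (s * p / 2) * ‖x - y‖ ^ (-(s * p / 2) - N) := by positivity
    rw [← one_div_rpow_eq hw.le N (s * p)]
    calc _ ≤ -(M ^ (p - 1)) / ‖x - y‖ ^ ((N : ℝ) + s * p) := by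
          have : M ^ (p - 1) * (1 / ‖x - y‖ ^ ((N : ℝ) + s * p)) =
            M ^ (p - 1) / ‖x - y‖ ^ ((N : ℝ) + s * p) := by ring
          rw [this, neg_div]
          linarith
      _ ≤ _ := by gcongr

/-- The exterior ball has volume proportional to r^N and lies within 3r of `x`, which gives a gain
whose coefficient does not involve β. The tail bound elsewhere costs a multiple of β^(p-1), plus a
constant depending on M and δ₀. -/
theorem IsBarrier.le_integral_compl_ball [NeZero N] (h : IsBarrier Ω δ₀ β ξ) (hp : 1 < p)
    (hsp : 0 < s * p) (hβ : 0 < β) (hβγ : β ≤ s * p / (2 * (p - 1))) {M : ℝ} (hM : ∀ y, ξ y ≤ M)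
    {x z : EuclideanSpace ℝ (Fin N)} (hx : x ∈ Ω) (hz : z ∈ frontier Ω)
    (hxz : bdryDist Ω x = ‖x - z‖) (hr : 0 < bdryDist Ω x) (hrδ : 2 * bdryDist Ω x ≤ δ₀)
    {κ : ℝ} (hκ : 0 < κ) (hκ1 : κ ≤ 1) {v : EuclideanSpace ℝ (Fin N)} (hv : ‖v‖ = 1)
    (hball : Metric.ball (z + bdryDist Ω x • v) (κ * bdryDist Ω x) ⊆ Ωᶜ)
    (hF : IntegrableOn (fracPLapIntegrand s p ξ x) (Metric.ball x (bdryDist Ω x))ᶜ) :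
    (κ ^ N * volume.real (Metric.ball (0 : EuclideanSpace ℝ (Fin N)) 1) * 3 ^ (-(s * p) - N) -
        N * volume.real (Metric.ball (0 : EuclideanSpace ℝ (Fin N)) 1) / (s * p / 2) *
          2 ^ (s * p / 2) * (β / (s * p / (2 * (p - 1)))) ^ (p - 1)) *
        bdryDist Ω x ^ (β * (p - 1) - s * p) -
      M ^ (p - 1) * (N * volume.real (Metric.ball (0 : EuclideanSpace ℝ (Fin N)) 1) / (s * p) *
        (δ₀ / 2) ^ (-(s * p))) ≤
      ∫ y in (Metric.ball x (bdryDist Ω x))ᶜ, fracPLapIntegrand s p ξ x y := by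
  have hdisj := ball_infDist_frontier_subset hx
  rw [← bdryDist] at hdisj
  set r := bdryDist Ω x with hrdef
  set γ := s * p / (2 * (p - 1)) with hγ
  set V := volume.real (Metric.ball (0 : EuclideanSpace ℝ (Fin N)) 1) with hV
  set S := (Metric.ball x r)ᶜ with hS
  have hSm : MeasurableSet S := Metric.isOpen_ball.measurableSet.compl
  set B := Metric.ball (z + r • v) (κ * r) with hB
  have hBm : MeasurableSet B := Metric.isOpen_ball.measurableSet
  have hBS : B ⊆ S := hball.trans (compl_subset_compl.2 hdisj)
  set Q := (r ^ β) ^ (p - 1) * (β / γ) ^ (p - 1) * (2 / r) ^ (s * p / 2) with hQ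
  set c := (r ^ β) ^ (p - 1) * (3 * r) ^ (-(s * p) - N) with hc
  have hδ : 0 < δ₀ / 2 := by linarith
  have hM0 : 0 ≤ M := (h.nonneg x).trans (hM x)
  have hp1 : 0 < p - 1 := by linarith
  have hγ0 : 0 < γ := by positivity
  have hDS : (Metric.ball x (δ₀ / 2))ᶜ ⊆ S :=
    compl_subset_compl.2 (Metric.ball_subset_ball (by linarith))
  have hDm : MeasurableSet (Metric.ball x (δ₀ / 2))ᶜ := Metric.isOpen_ball.measurableSet.compl
  have i1 : IntegrableOn (fun y => Q * ‖x - y‖ ^ (-(s * p / 2) - N)) S := by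
    have := (integrableOn_compl_ball_rpow volume x hr (half_pos hsp)).const_mul Q
    rwa [finrank_euclideanSpace_fin] at this
  have i2' : IntegrableOn (fun y => M ^ (p - 1) * ‖x - y‖ ^ (-(s * p) - N))
      (Metric.ball x (δ₀ / 2))ᶜ := by
    have := (integrableOn_compl_ball_rpow volume x hδ hsp).const_mul (M ^ (p - 1))
    rwa [finrank_euclideanSpace_fin] at this
  have i2 : IntegrableOn ((Metric.ball x (δ₀ / 2))ᶜ.indicator
      fun y => M ^ (p - 1) * ‖x - y‖ ^ (-(s * p) - N)) S :=
    ((integrable_indicator_iff hDm).2 i2').integrableOn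
  have i3 : IntegrableOn (B.indicator fun _ => c) S :=
    ((integrable_indicator_iff hBm).2
      (integrableOn_const measure_ball_lt_top.ne)).integrableOn
  -- The negative terms may be kept on `B` as well: there they only weaken the bound by `c`.
  have hpt : ∀ y ∈ S, -(Q * ‖x - y‖ ^ (-(s * p / 2) - N)) - (Metric.ball x (δ₀ / 2))ᶜ.indicator
      (fun y => M ^ (p - 1) * ‖x - y‖ ^ (-(s * p) - N)) y + B.indicator (fun _ => c) y ≤
      fracPLapIntegrand s p ξ x y := fun y hy => by
    have hyr : r ≤ ‖x - y‖ := by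
      rwa [hS, mem_compl_iff, mem_ball_iff_norm', not_lt] at hy
    by_cases hyB : y ∈ B
    · have h5 : ξ x = r ^ β := h.eq_strip x ⟨hx, by linarith⟩
      have h0 : ξ y = 0 := h.eq_zero y (hball hyB)
      have hw : 0 < ‖x - y‖ := hr.trans_le hyr
      have hw3 : ‖x - y‖ ≤ 3 * r := by
        have e : x - y = (x - z) - r • v - (y - (z + r • v)) := by abel
        rw [e]
        refine (norm_sub_le _ _).trans ?_
        have e1 := norm_sub_le (x - z) (r • v)
        rw [norm_smul, hv, ← hxz, Real.norm_of_nonneg hr.le] at e1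
        rw [hB, mem_ball_iff_norm] at hyB
        nlinarith
      have hF' : fracPLapIntegrand s p ξ x y =
          (r ^ β) ^ (p - 1) * ‖x - y‖ ^ (-(s * p) - N) := by
        rw [fracPLapIntegrand_eq, h0, sub_zero, h5, oddPow_of_nonneg hp (by positivity),
          ← one_div_rpow_eq hw.le]
        ring
      have h6 : c ≤ fracPLapIntegrand s p ξ x y := by
        rw [hF', hc]
        have : -(s * p) - (N : ℝ) ≤ 0 := by
          have : (0 : ℝ) ≤ N := N.cast_nonneg
          linarith
        gcongr ?_ * ?_
        exact Real.rpow_le_rpow_of_nonpos hw hw3 this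
      have hind : 0 ≤ (Metric.ball x (δ₀ / 2))ᶜ.indicator
          (fun y => M ^ (p - 1) * ‖x - y‖ ^ (-(s * p) - N)) y :=
        indicator_nonneg (fun y _ => by positivity) y
      have h7 : 0 ≤ Q * ‖x - y‖ ^ (-(s * p / 2) - N) := by positivity
      rw [indicator_of_mem hyB]
      linarith
    · rw [indicator_of_notMem hyB, add_zero]
      exact h.neg_le_integrand hp hsp hβ hβγ hM hx hz hxz hr hrδ hyr
  have hmono := setIntegral_mono_on ((i1.neg.sub i2).add i3) hF hSm hpt
  refine le_trans (le_of_eq ?_) hmono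
  have j1 : ∫ y in S, Q * ‖x - y‖ ^ (-(s * p / 2) - N) =
      Q * (N * V / (s * p / 2) * r ^ (-(s * p / 2))) := by
    have := integral_compl_ball_rpow volume x hr (half_pos hsp)
    rw [finrank_euclideanSpace_fin] at this
    rw [integral_const_mul, this]
  have j2 : ∫ y in S, (Metric.ball x (δ₀ / 2))ᶜ.indicator
      (fun y => M ^ (p - 1) * ‖x - y‖ ^ (-(s * p) - N)) y =
      M ^ (p - 1) * (N * V / (s * p) * (δ₀ / 2) ^ (-(s * p))) := by
    have := integral_compl_ball_rpow volume x hδ hsp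
    rw [finrank_euclideanSpace_fin] at this
    rw [setIntegral_indicator hDm, inter_eq_right.2 hDS, integral_const_mul, this]
  have j3 : ∫ y in S, B.indicator (fun _ => c) y = (κ * r) ^ N * V * c := by
    have := Measure.addHaar_ball (volume : Measure (EuclideanSpace ℝ (Fin N))) (z + r • v)
      (mul_pos hκ hr).le
    rw [finrank_euclideanSpace_fin] at this
    rw [setIntegral_indicator hBm, inter_eq_right.2 hBS, setIntegral_const, smul_eq_mul,
      measureReal_def, this, ENNReal.toReal_mul, ENNReal.toReal_ofReal (by positivity), hV,
      measureReal_def]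
  have hsum : ∫ y in S, (-(Q * ‖x - y‖ ^ (-(s * p / 2) - N)) -
      (Metric.ball x (δ₀ / 2))ᶜ.indicator (fun y => M ^ (p - 1) * ‖x - y‖ ^ (-(s * p) - N)) y +
      B.indicator (fun _ => c) y) =
      -(Q * (N * V / (s * p / 2) * r ^ (-(s * p / 2)))) -
        M ^ (p - 1) * (N * V / (s * p) * (δ₀ / 2) ^ (-(s * p))) + (κ * r) ^ N * V * c := by
    have := integral_add' (i1.neg.sub i2) i3
    rw [integral_sub' i1.neg i2, integral_neg', j1, j2, j3] at this
    exact this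
  refine Eq.trans ?_ hsum.symm
  have hP : r ^ (β * (p - 1) - s * p) = (r ^ β) ^ (p - 1) * r ^ (-(s * p)) := by
    rw [← Real.rpow_mul hr.le, ← Real.rpow_add hr]; ring_nf
  have hQ' : Q * r ^ (-(s * p / 2)) =
      2 ^ (s * p / 2) * (β / γ) ^ (p - 1) * r ^ (β * (p - 1) - s * p) := by
    have e : r ^ (-(s * p)) = (r ^ (s * p / 2))⁻¹ * r ^ (-(s * p / 2)) := by
      rw [← Real.rpow_neg hr.le, ← Real.rpow_add hr]; ring_nf
    rw [hP, e, hQ, Real.div_rpow zero_le_two hr.le]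
    ring
  have hc' : r ^ N * c = 3 ^ (-(s * p) - N) * r ^ (β * (p - 1) - s * p) := by
    have e : r ^ (-(s * p)) = r ^ N * r ^ (-(s * p) - N) := by
      rw [← Real.rpow_natCast, ← Real.rpow_add hr]; ring_nf
    rw [hP, e, hc, Real.mul_rpow (by norm_num) hr.le]
    ring
  calc _ = κ ^ N * V * (3 ^ (-(s * p) - N) * r ^ (β * (p - 1) - s * p)) -
        N * V / (s * p / 2) *
          (2 ^ (s * p / 2) * (β / γ) ^ (p - 1) * r ^ (β * (p - 1) - s * p)) -
        M ^ (p - 1) * (N * V / (s * p) * (δ₀ / 2) ^ (-(s * p))) := by ring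
    _ = _ := by rw [← hQ', ← hc', mul_pow]; ring

end

/-! ### Choice of constants and conclusion -/

theorem exists_pos_forall_mul_rpow_le {K c q : ℝ} (hK : 0 ≤ K) (hc : 0 < c) (hq : 0 < q) :
    ∃ b : ℝ, 0 < b ∧ ∀ t : ℝ, 0 ≤ t → t ≤ b → K * t ^ q ≤ c := by
  refine ⟨(c / (K + 1)) ^ q⁻¹, by positivity, fun t ht htb => ?_⟩
  have h : t ^ q ≤ c / (K + 1) := by
    refine (Real.rpow_le_rpow ht htb hq.le).trans_eq ?_
    rw [← Real.rpow_mul (by positivity), inv_mul_cancel₀ hq.ne', Real.rpow_one]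
  rw [le_div_iff₀ (by positivity)] at h
  have : 0 ≤ t ^ q := by positivity
  nlinarith

theorem lemma3p2 {N : ℕ} (hN : 2 ≤ N) (s p : ℝ) (hs0 : 0 < s) (hs1 : s < 1)
    (hp : 2 / (2 - s) < p)
    (Ω : Set (EuclideanSpace ℝ (Fin N))) (hΩo : IsOpen Ω) (hΩb : Bornology.IsBounded Ω)
    (hΩ2 : HasC2Boundary Ω) :
    ∃ C : ℝ, 0 < C ∧ ∃ β₀ : ℝ, 0 < β₀ ∧ β₀ < s * p / (p - 1) ∧
      ∀ δ₀ : ℝ, 0 < δ₀ → ContDiffOn ℝ 2 (bdryDist Ω) (bdryStrip Ω δ₀) →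
      ∀ M : ℝ, ∃ δ : ℝ, 0 < δ ∧ δ ≤ δ₀ ∧
        ∀ β : ℝ, 0 < β → β < β₀ →
        ∀ ξ : EuclideanSpace ℝ (Fin N) → ℝ, IsBarrier Ω δ₀ β ξ → (∀ x, ξ x ≤ M) →
        ∀ x ∈ bdryStrip Ω δ,
          FracPLapExists s p ξ x ∧
            -fracPLap s p ξ x ≤ -C * bdryDist Ω x ^ (β * (p - 1) - s * p) := by
  have : NeZero N := ⟨by omega⟩
  have hp2 : 2 < p * (2 - s) := (div_lt_iff₀ (by linarith)).1 hp
  have hp1 : 1 < p := by nlinarith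
  have hpm : 0 < p - 1 := by linarith
  have hsp : 0 < s * p := by positivity
  have hsp' : s * p < min p (2 * (p - 1)) := lt_min (by nlinarith) (by linarith)
  obtain ⟨κ, hκ, hκ1, t₀, ht₀, hext⟩ := hΩ2.exists_exterior_balls hΩo hΩb
  obtain ⟨C₁, hC₁, hnear⟩ := exists_neg_le_integral_annulus (N := N) hp1 hsp hsp'
  set V := volume.real (Metric.ball (0 : EuclideanSpace ℝ (Fin N)) 1) with hV
  have hV0 : 0 < V := ENNReal.toReal_pos (Metric.measure_ball_pos _ _ one_pos).ne'
    measure_ball_lt_top.ne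
  set c := κ ^ N * V * 3 ^ (-(s * p) - N) with hc
  have hc0 : 0 < c := by positivity
  set γ := s * p / (2 * (p - 1)) with hγ
  have hγ0 : 0 < γ := by positivity
  have hγlt : γ < s * p / (p - 1) := by
    rw [hγ]
    exact div_lt_div_of_pos_left hsp hpm (by linarith)
  set C₂ := N * V / (s * p / 2) * 2 ^ (s * p / 2) / γ ^ (p - 1) with hC₂
  have hC₂0 : 0 ≤ C₂ := by positivity
  -- For β ≤ b the near and tail losses together cost at most a third of the gain `c`.
  obtain ⟨b, hb, hbK⟩ := exists_pos_forall_mul_rpow_le (add_nonneg hC₁ hC₂0)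
    (by positivity : 0 < c / 3) hpm
  -- Of the gain `c`, one third survives, doubled by the factor 2 in the operator. The bound β ≤ 1
  -- serves the paraboloid, β ≤ γ the tail.
  refine ⟨2 * c / 3, by positivity, min b (min 1 γ), by positivity,
    ((min_le_right _ _).trans (min_le_right _ _)).trans_lt hγlt, fun δ₀ hδ₀ _ M => ?_⟩
  -- At this point no barrier is at hand, so M may be negative; the absolute value keeps `W`
  -- nonnegative.
  set W := |M| ^ (p - 1) * (N * V / (s * p) * (δ₀ / 2) ^ (-(s * p))) with hW
  have hW0 : 0 ≤ W := by positivity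
  obtain ⟨δ₁, hδ₁, hδ₁W⟩ := exists_pos_forall_mul_rpow_le hW0 (by positivity : 0 < c / 3)
    (half_pos hsp)
  refine ⟨min (δ₀ / 2) (min t₀ (min 1 δ₁)), by positivity,
    (min_le_left _ _).trans (by linarith), fun β hβ hββ ξ hξ hM x hx => ?_⟩
  have hβb : β ≤ b := hββ.le.trans (min_le_left _ _)
  have hβ1 : β ≤ 1 := hββ.le.trans ((min_le_right _ _).trans (min_le_left _ _))
  have hβγ : β ≤ γ := hββ.le.trans ((min_le_right _ _).trans (min_le_right _ _))
  obtain ⟨hxΩ, hxd⟩ := hx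
  simp only [lt_min_iff] at hxd
  obtain ⟨hrδ, hrt, hr1, hrδ₁⟩ := hxd
  have hM0 : 0 ≤ M := (hξ.nonneg x).trans (hM x)
  have hne : (frontier Ω).Nonempty := nonempty_frontier_iff.2 ⟨⟨x, hxΩ⟩, fun h => by
    rw [h] at hΩb
    exact NoncompactSpace.noncompact_univ (X := EuclideanSpace ℝ (Fin N))
      (Metric.isCompact_of_isClosed_isBounded isClosed_univ hΩb)⟩
  obtain ⟨z, hz, hxz⟩ := isClosed_frontier.exists_infDist_eq_dist hne x
  rw [dist_eq_norm] at hxz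
  have hr : 0 < bdryDist Ω x :=
    (isClosed_frontier.notMem_iff_infDist_pos hne).1 fun h =>
      (hΩo.frontier_eq ▸ h : x ∈ closure Ω \ Ω).2 hxΩ
  obtain ⟨v, hv, hball⟩ := hext z hz _ hr hrt
  have hex : FracPLapExists s p ξ x :=
    fracPLapExists_of_contDiffAt hp1 hsp hsp' (hξ.measurable hΩo) (B := M)
      (fun y => by rw [abs_of_nonneg (hξ.nonneg y)]; exact hM y)
      (hξ.contDiffOn.contDiffAt (hΩo.mem_nhds hxΩ))
  refine ⟨hex, ?_⟩
  obtain ⟨hint, L, hL⟩ := hex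
  rw [fracPLap, hL.limUnder_eq]
  obtain ⟨ℓ, hℓ, hpar⟩ := hξ.exists_paraboloid hβ.le hβ1 hxΩ hz hxz hr (by linarith)
  have hfar := hξ.le_integral_compl_ball hp1 hsp hβ hβγ hM hxΩ hz hxz hr (by linarith) hκ hκ1 hv
    hball (hint _ hr)
  set r := bdryDist Ω x with hrdef
  set P := r ^ (β * (p - 1) - s * p) with hP
  have hP0 : 0 < P := by positivity
  have hP1 : (β * r ^ β) ^ (p - 1) * r ^ (-(s * p)) = β ^ (p - 1) * P := by
    rw [Real.mul_rpow hβ.le (by positivity), ← Real.rpow_mul hr.le, mul_assoc, ← Real.rpow_add hr,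
      hP]
    ring_nf
  have hsmall : (C₁ + C₂) * β ^ (p - 1) * P ≤ c / 3 * P := by
    gcongr
    exact hbK β hβ.le hβb
  have hWP : W ≤ c / 3 * P := by
    have h1 := hδ₁W r hr.le hrδ₁.le
    -- Since r < 1 and β(p-1) ≤ γ(p-1) = sp/2, P blows up at least like r^(-sp/2), uniformly in β;
    -- hence δ can be chosen before β.
    have h2 : r ^ (-(s * p / 2)) ≤ P := by
      refine Real.rpow_le_rpow_of_exponent_ge hr hr1.le ?_
      have : β * (p - 1) ≤ γ * (p - 1) := by gcongr
      have h3 : γ * (p - 1) = s * p / 2 := by rw [hγ]; field_simp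
      linarith
    calc W = W * r ^ (s * p / 2) * r ^ (-(s * p / 2)) := by
          rw [mul_assoc, ← Real.rpow_add hr, add_neg_cancel, Real.rpow_zero, mul_one]
      _ ≤ c / 3 * P := by gcongr
  have hC₂β : N * V / (s * p / 2) * 2 ^ (s * p / 2) * (β / γ) ^ (p - 1) = C₂ * β ^ (p - 1) := by
    rw [Real.div_rpow hβ.le hγ0.le, hC₂]; ring
  rw [hC₂β, ← abs_of_nonneg hM0, ← hW] at hfar
  have hlow : ∀ᶠ ε in 𝓝[>] (0 : ℝ), 2 * c / 3 * P ≤ fracPLapTrunc s p ξ x ε := by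
    filter_upwards [self_mem_nhdsWithin,
      eventually_nhdsWithin_of_eventually_nhds (eventually_le_nhds hr)] with ε hε hεr
    have h1 := hnear ξ x ε r (β * r ^ β) ℓ hε hr (by positivity) (hint ε hε) hpar hℓ
    rw [mul_assoc, hP1] at h1
    rw [fracPLapTrunc_eq_add hεr (hint ε hε)]
    linarith
  have := ge_of_tendsto hL hlow
  linarith
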